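/- Let $M_1$ and $M_2$ be compact connected smooth manifolds whose fundamental groups are infinite and residually finite. For $i=1,2$ let $\tilde M_i\to M_i$ be the universal covering and let $G_i=\widehat{\pi_1(M_i)}$ be the profinite completion of the fundamental group, i.e. the inverse limit of the finite quotients $\pi_1(M_i)/H$ over the normal subgroups $H$ of finite index. Let $\mathbb M_i=\varprojlim_H H\backslash\tilde M_i$ be the algebraic universal solenoidal cover of $M_i$, the inverse limit of the coverings of $M_i$ that correspond to these subgroups $H$. Let $\hat\Pi_i:\tilde M_i\times G_i\to\mathbb M_i$ be the canonical projection, $\hat\Pi_i(y,(c_HH)_H)=(H\,c_H^{-1}y)_H$, which is the quotient map for the action $\gamma(y,g)=(\gamma y,j(\gamma)g)$ of $\pi_1(M_i)$, where $j:\pi_1(M_i)\to G_i$ is the canonical homomorphism. The leaves of $\mathbb M_i$ are its path components, i.e. the sets $\hat\Pi_i(\tilde M_i\times\{g\})$. (a) Let $f:\mathbb M_1\to\mathbb M_2$ be a continuous map. Then there is a continuous map $\tilde f:\tilde M_1\times G_1\to\tilde M_2\times G_2$ with $f\circ\hat\Pi_1=\hat\Pi_2\circ\tilde f$, of the form $$\tilde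 f(y,g)=(\tilde f_g(y),h(g)),$$ where $h:G_1\to G_2$ is continuous and every $\tilde f_g:\tilde M_1\to\tilde M_2$ is continuous. (b) Suppose that $\mathbb M_2$ has a laminated Riemannian metric (continuous on $\mathbb M_2$ and smooth along the leaves) for which all leaves have negative sectional curvature. Let $f:\mathbb M_2\to\mathbb M_2$ be a continuous map with $f(L)=L$ for every leaf $L$. Then there is a continuous map $\tilde f:\tilde M_2\times G_2\to\tilde M_2\times G_2$ with $f\circ\hat\Pi_2=\hat\Pi_2\circ\tilde f$, of the form $\tilde f(y,g)=(\tilde f_g(y),g)$ with every $\tilde f_g:\tilde M_2\to\tilde M_2$ continuous; that is, $h$ can be taken to be the identity. -/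

import Mathlib

open scoped Manifold ContDiff Topology

namespace SolenoidLift

universe u v

theorem monodromy_cast {M : Type u} {W : Type v} [TopologicalSpace M] [TopologicalSpace W]
    {p : W → M} (hp : IsCoveringMap p) {x y y' : M} (q : Path.Homotopic.Quotient x y)
    (h : y' = y) (w : p ⁻¹' {x}) :
    (hp.monodromy (q.cast rfl h) w).1 = (hp.monodromy q w).1 := by
  subst h
  rw [Path.Homotopic.Quotient.cast_rfl_rfl]

noncomputable section FundamentalGroupAction

variable {M : Type u} {W : Type v} [TopologicalSpace M] [TopologicalSpace W]
  [SimplyConnectedSpace W] {p : W → M}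

/-- The homotopy class of the paths from `e` to `y` in the simply connected space `W`. -/
def pathClass (e y : W) : Path.Homotopic.Quotient e y :=
  .mk (PathConnectedSpace.somePath e y)

/-- The image in `M` of the class of the paths from `e` to `y`. -/
def projClass (hp : IsCoveringMap p) (e y : W) : Path.Homotopic.Quotient (p e) (p y) :=
  (pathClass e y).map ⟨p, hp.continuous⟩

/-- The action of a class `γ` of loops at `p e` on the universal cover `p : W → M`, by deck
transformations: `y` goes to the end point of the lift, starting at the base point `e`, of the
path `γ⁻¹` followed by the projection of a path from `e` to `y`. (Mathlib multiplies in the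
fundamental group in the order opposite to concatenation of loops: `γ * δ` is `δ` followed by `γ`.
Hence the inverse, which makes this a left action.) -/
def deckFun (hp : IsCoveringMap p) (e : W) (γ : FundamentalGroup M (p e)) (y : W) : W :=
  (hp.monodromy (Path.Homotopic.Quotient.trans γ.toPath.symm (projClass hp e y)) ⟨e, rfl⟩).1

theorem proj_deckFun (hp : IsCoveringMap p) (e : W) (γ : FundamentalGroup M (p e)) (y : W) :
    p (deckFun hp e γ y) = p y :=
  (hp.monodromy (Path.Homotopic.Quotient.trans γ.toPath.symm (projClass hp e y)) ⟨e, rfl⟩).2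

theorem pathClass_eq {e y : W} (q : Path.Homotopic.Quotient e y) : q = pathClass e y := by
  induction q using Path.Homotopic.Quotient.ind with
  | mk q => exact Path.Homotopic.Quotient.eq.mpr (SimplyConnectedSpace.paths_homotopic _ _)

theorem projClass_deckFun (hp : IsCoveringMap p) (e : W) (γ : FundamentalGroup M (p e)) (y : W) :
    projClass hp e (deckFun hp e γ y) =
      (Path.Homotopic.Quotient.trans γ.toPath.symm (projClass hp e y)).cast rfl
        (proj_deckFun hp e γ y) := by
  have h := hp.map_liftPathQuotient
    (Path.Homotopic.Quotient.trans γ.toPath.symm (projClass hp e y)) ⟨e, rfl⟩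
  rw [pathClass_eq (hp.liftPathQuotient _ _)] at h
  exact h

theorem deckFun_eq (hp : IsCoveringMap p) (e : W) (γ : FundamentalGroup M (p e)) (y : W) :
    deckFun hp e γ y =
      (hp.monodromy (projClass hp e y) (hp.monodromy γ.toPath.symm ⟨e, rfl⟩)).1 :=
  congrArg Subtype.val (hp.monodromy_trans_apply _ _ _)

theorem deckFun_one (hp : IsCoveringMap p) (e y : W) : deckFun hp e 1 y = y := by
  have h1 : FundamentalGroup.toPath (1 : FundamentalGroup M (p e))⁻¹ =
      Path.Homotopic.Quotient.refl (p e) := by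
    rw [inv_one]; rfl
  have h2 : hp.monodromy (FundamentalGroup.toPath (1 : FundamentalGroup M (p e))⁻¹) ⟨e, rfl⟩ =
      ⟨e, rfl⟩ := by
    rw [h1, hp.monodromy_refl]; rfl
  rw [deckFun_eq]
  exact (congrArg (fun w => (hp.monodromy (projClass hp e y) w).1) h2).trans
    (congrArg Subtype.val (hp.monodromy_map (pathClass e y)))

theorem deckFun_mul (hp : IsCoveringMap p) (e : W) (γ δ : FundamentalGroup M (p e)) (y : W) :
    deckFun hp e (γ * δ) y = deckFun hp e γ (deckFun hp e δ y) := by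
  have h1 : FundamentalGroup.toPath (γ * δ)⁻¹ =
      Path.Homotopic.Quotient.trans (FundamentalGroup.toPath γ⁻¹)
        (FundamentalGroup.toPath δ⁻¹) := by
    rw [mul_inv_rev]; rfl
  have h2 : hp.monodromy (FundamentalGroup.toPath (γ * δ)⁻¹) ⟨e, rfl⟩ =
      hp.monodromy (FundamentalGroup.toPath δ⁻¹)
        (hp.monodromy (FundamentalGroup.toPath γ⁻¹) ⟨e, rfl⟩) := by
    rw [h1, hp.monodromy_trans_apply]
  rw [deckFun_eq hp e γ, projClass_deckFun, monodromy_cast, hp.monodromy_trans_apply, deckFun_eq]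
  exact congrArg (fun w => (hp.monodromy (projClass hp e y) w).1) h2

/-- The action of `π₁(M, p e)` on the universal cover `p : W → M` by deck transformations. -/
def deck (hp : IsCoveringMap p) (e : W) : FundamentalGroup M (p e) →* Equiv.Perm W where
  toFun γ :=
    { toFun := deckFun hp e γ
      invFun := deckFun hp e γ⁻¹
      left_inv := fun y => by rw [← deckFun_mul, inv_mul_cancel, deckFun_one]
      right_inv := fun y => by rw [← deckFun_mul, mul_inv_cancel, deckFun_one] }
  map_one' := Equiv.ext fun y => deckFun_one hp e y
  map_mul' γ δ := Equiv.ext fun y => deckFun_mul hp e γ δ y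

end FundamentalGroupAction

noncomputable section Solenoid

variable {M : Type u} {W : Type v} [TopologicalSpace M] [TopologicalSpace W]
  [SimplyConnectedSpace W] {p : W → M}

/-- Two points of the universal cover are equivalent if a deck transformation given by an element
of the subgroup `H` of the fundamental group takes one to the other. -/
def deckSetoid (hp : IsCoveringMap p) (e : W) (H : Subgroup (FundamentalGroup M (p e))) :
    Setoid W where
  r y z := ∃ γ ∈ H, deck hp e γ y = z
  iseqv :=
    { refl := fun y => ⟨1, H.one_mem, deckFun_one hp e y⟩
      symm := by
        rintro y z ⟨γ, hγ, rfl⟩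
        exact ⟨γ⁻¹, H.inv_mem hγ, (deck hp e γ).left_inv y⟩
      trans := by
        rintro x y z ⟨γ, hγ, rfl⟩ ⟨δ, hδ, rfl⟩
        exact ⟨δ * γ, H.mul_mem hδ hγ, deckFun_mul hp e δ γ x⟩ }

/-- The connected covering space of `M` that corresponds to the subgroup `H` of the fundamental
group: the orbit space `H \ W` of the universal cover, with the quotient topology. For `H = ⊤`
it is `M` itself. -/
def Cover (hp : IsCoveringMap p) (e : W) (H : Subgroup (FundamentalGroup M (p e))) : Type v :=
  Quotient (deckSetoid hp e H)

instance (hp : IsCoveringMap p) (e : W) (H : Subgroup (FundamentalGroup M (p e))) :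
    TopologicalSpace (Cover hp e H) :=
  inferInstanceAs (TopologicalSpace (Quotient (deckSetoid hp e H)))

/-- The covering projection of the universal cover onto the cover given by `H`. -/
def Cover.mk (hp : IsCoveringMap p) (e : W) (H : Subgroup (FundamentalGroup M (p e))) (y : W) :
    Cover hp e H :=
  Quotient.mk (deckSetoid hp e H) y

/-- The bonding covering projection between the covers given by two subgroups `H ≤ K`. -/
def Cover.bond (hp : IsCoveringMap p) (e : W) {H K : Subgroup (FundamentalGroup M (p e))}
    (hHK : H ≤ K) : Cover hp e H → Cover hp e K :=
  Quotient.map' id fun _ _ ⟨γ, hγ, h⟩ => ⟨γ, hHK hγ, h⟩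

/-- The algebraic universal solenoidal cover of `M`: the inverse limit of the covers of `M` given by
the normal subgroups of finite index of its fundamental group, with the topology of a subspace of
the product. -/
def AlgUnivCover (hp : IsCoveringMap p) (e : W) : Type (max u v) :=
  {x : ∀ H : FiniteIndexNormalSubgroup (FundamentalGroup M (p e)), Cover hp e H.toSubgroup //
    ∀ (H K : FiniteIndexNormalSubgroup (FundamentalGroup M (p e)))
      (hHK : H.toSubgroup ≤ K.toSubgroup), Cover.bond hp e hHK (x H) = x K}

instance (hp : IsCoveringMap p) (e : W) : TopologicalSpace (AlgUnivCover hp e) :=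
  inferInstanceAs (TopologicalSpace (Subtype _))

/-- The profinite completion of the fundamental group `π₁(M, x)`: the inverse limit of its
quotients by normal subgroups of finite index. -/
abbrev ProfinitePi (M : Type u) [TopologicalSpace M] (x : M) : ProfiniteGrp.{u} :=
  ProfiniteGrp.ProfiniteCompletion.completion (GrpCat.of (FundamentalGroup M x))

/-- The canonical homomorphism of `π₁(M, x)` to its profinite completion. -/
def toProfinitePi (M : Type u) [TopologicalSpace M] (x : M) (γ : FundamentalGroup M x) :
    ProfinitePi M x :=
  ProfiniteGrp.ProfiniteCompletion.etaFn (GrpCat.of (FundamentalGroup M x)) γ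

/-- The point `c⁻¹ y` of the cover given by the normal subgroup `H`, for a coset `cH`. -/
def cosetPoint (hp : IsCoveringMap p) (e : W)
    (H : FiniteIndexNormalSubgroup (FundamentalGroup M (p e)))
    (c : FundamentalGroup M (p e) ⧸ H.toSubgroup) (y : W) : Cover hp e H.toSubgroup :=
  Quotient.liftOn' c (fun c => Cover.mk hp e H.toSubgroup (deck hp e c⁻¹ y)) (by
    intro c d h
    rw [QuotientGroup.leftRel_apply] at h
    have h' : (c⁻¹ * d)⁻¹ ∈ H.toSubgroup := H.toSubgroup.inv_mem h
    rw [mul_inv_rev, inv_inv] at h'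
    refine Quotient.sound ⟨d⁻¹ * c, h', ?_⟩
    change deckFun hp e (d⁻¹ * c) (deckFun hp e c⁻¹ y) = deckFun hp e d⁻¹ y
    rw [← deckFun_mul, mul_assoc, mul_inv_cancel, mul_one])

/-- The component of an element of the profinite completion in the quotient by `H`. -/
def component {M : Type u} [TopologicalSpace M] {x : M} (g : ProfinitePi M x)
    (H : FiniteIndexNormalSubgroup (FundamentalGroup M x)) :
    FundamentalGroup M x ⧸ H.toSubgroup :=
  g.1 H

theorem map_component {M : Type u} [TopologicalSpace M] {x : M} (g : ProfinitePi M x)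
    {H K : FiniteIndexNormalSubgroup (FundamentalGroup M x)} (h : H.toSubgroup ≤ K.toSubgroup) :
    QuotientGroup.map H.toSubgroup K.toSubgroup (MonoidHom.id _) h (component g H) =
      component g K :=
  g.2 (CategoryTheory.homOfLE (show H ≤ K from h))

/-- The solenoidal covering projection of `W × π̂₁(M)` onto the algebraic universal cover of `M`:
the quotient map for the action `γ (y, g) = (γ y, j(γ) g)` of `π₁(M)`. Its component at `H` is the
class of `c⁻¹ y`, where `cH` is the component of `g` at `H`. -/
def solenoidProj (hp : IsCoveringMap p) (e : W) (z : W × ProfinitePi M (p e)) :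
    AlgUnivCover hp e :=
  ⟨fun H => cosetPoint hp e H (component z.2 H) z.1, by
    intro H K hHK
    obtain ⟨c, hc⟩ := QuotientGroup.mk_surjective (component z.2 H)
    change Cover.bond hp e hHK (cosetPoint hp e H (component z.2 H) z.1) =
      cosetPoint hp e K (component z.2 K) z.1
    rw [← map_component z.2 hHK, ← hc]
    rfl⟩

/-- A leaf of the algebraic universal cover. Since the transversals are totally disconnected, the
leaves (the unions of chains of plaques) are the path components. -/
def IsLeaf (hp : IsCoveringMap p) (e : W) (L : Set (AlgUnivCover hp e)) : Prop :=
  ∃ x, L = pathComponent x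

end Solenoid

noncomputable section Curvature

variable {n : ℕ} {W : Type v} [TopologicalSpace W] [ChartedSpace (EuclideanSpace ℝ (Fin n)) W]
  [IsManifold (𝓡 n) ∞ W]

/-- Smooth Riemannian metrics on a smooth manifold of dimension `n`. -/
abbrev SmoothMetric (n : ℕ) (W : Type v) [TopologicalSpace W]
    [ChartedSpace (EuclideanSpace ℝ (Fin n)) W] [IsManifold (𝓡 n) ∞ W] :=
  Bundle.ContMDiffRiemannianMetric (𝓡 n) ∞ (EuclideanSpace ℝ (Fin n))
    (fun y : W => TangentSpace (𝓡 n) y)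

namespace SmoothMetric

/-- The coefficients `g_ij` of a metric in the chart at `y`, as functions on the chart's target. -/
def coeff (g : SmoothMetric n W) (y : W) (u : EuclideanSpace ℝ (Fin n)) :
    Matrix (Fin n) (Fin n) ℝ :=
  Matrix.of fun i j =>
    let φ := (extChartAt (𝓡 n) y).symm
    g.inner (φ u)
      (mfderiv 𝓘(ℝ, EuclideanSpace ℝ (Fin n)) (𝓡 n) φ u (EuclideanSpace.single i (1 : ℝ)))
      (mfderiv 𝓘(ℝ, EuclideanSpace ℝ (Fin n)) (𝓡 n) φ u (EuclideanSpace.single j (1 : ℝ)))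

/-- The partial derivative `∂_i F` of a function on `ℝⁿ`. -/
def partialDeriv (i : Fin n) (F : EuclideanSpace ℝ (Fin n) → ℝ) (u : EuclideanSpace ℝ (Fin n)) :
    ℝ :=
  fderiv ℝ F u (EuclideanSpace.single i (1 : ℝ))

/-- The Christoffel symbol `Γ^l_ij` of the Levi-Civita connection in the chart at `y`. -/
def christoffel (g : SmoothMetric n W) (y : W) (l i j : Fin n) (u : EuclideanSpace ℝ (Fin n)) :
    ℝ :=
  (1 / 2) * ∑ m, (g.coeff y u)⁻¹ l m *
    (partialDeriv i (fun v => g.coeff y v j m) u + partialDeriv j (fun v => g.coeff y v i m) u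
      - partialDeriv m (fun v => g.coeff y v i j) u)

/-- The component along `∂_l` of `R(∂_i, ∂_j) ∂_k` in the chart at `y`, where
`R(X, Y) Z = ∇_X ∇_Y Z - ∇_Y ∇_X Z - ∇_[X, Y] Z`. -/
def riemann (g : SmoothMetric n W) (y : W) (l i j k : Fin n) (u : EuclideanSpace ℝ (Fin n)) : ℝ :=
  partialDeriv i (g.christoffel y l j k) u - partialDeriv j (g.christoffel y l i k) u
    + ∑ s, (g.christoffel y l i s u * g.christoffel y s j k u
      - g.christoffel y l j s u * g.christoffel y s i k u)

/-- The sectional curvature at `y` of the plane spanned by the tangent vectors with linearly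
independent coordinate vectors `a` and `b` in the chart at `y`:
`⟨R(a, b) b, a⟩ / (|a|² |b|² - ⟨a, b⟩²)`. -/
def sectionalCurvature (g : SmoothMetric n W) (y : W) (a b : Fin n → ℝ) : ℝ :=
  let u := extChartAt (𝓡 n) y y
  let ip := fun v w : Fin n → ℝ => ∑ i, ∑ j, g.coeff y u i j * v i * w j
  ip (fun l => ∑ i, ∑ j, ∑ k, g.riemann y l i j k u * a i * b j * b k) a /
    (ip a a * ip b b - ip a b ^ 2)

/-- All sectional curvatures are negative. -/
def IsNegativelyCurved (g : SmoothMetric n W) : Prop :=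
  ∀ (y : W) (a b : Fin n → ℝ), LinearIndependent ℝ ![a, b] → g.sectionalCurvature y a b < 0

end SmoothMetric

/-- A laminated Riemannian metric on the algebraic universal cover of `M`, given by its pull-back
to `W × π̂₁(M)`: a smooth Riemannian metric on every leaf `W × {g}`, such that the family is
continuous on `W × π̂₁(M)` and invariant under the action `γ (y, g) = (γ y, j(γ) g)` of `π₁(M)`,
whose orbit space is the algebraic universal cover. -/
structure LaminatedMetric {M : Type u} [TopologicalSpace M] [SimplyConnectedSpace W] {p : W → M}
    (hp : IsCoveringMap p) (e : W) where
  /-- the metric on the leaf `W × {g}` -/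
  metric : ProfinitePi M (p e) → SmoothMetric n W
  continuous_inner : Continuous fun z : TangentBundle (𝓡 n) W × ProfinitePi M (p e) =>
    (metric z.2).inner z.1.proj z.1.snd z.1.snd
  invariant : ∀ (γ : FundamentalGroup M (p e)) (g : ProfinitePi M (p e)) (y : W)
    (v w : TangentSpace (𝓡 n) y),
    (metric (toProfinitePi M (p e) γ * g)).inner (deck hp e γ y)
      (mfderiv (𝓡 n) (𝓡 n) (deck hp e γ) y v) (mfderiv (𝓡 n) (𝓡 n) (deck hp e γ) y w) =
    (metric g).inner y v w

end Curvature

end SolenoidLift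

/-! The diagonal action of `π₁(M)` on `W × π̂₁(M)` is free and properly discontinuous, and its
orbits are the fibres of `solenoidProj`, so `solenoidProj` is a covering map
(`isQuotientCoveringMap_solenoidProj`). Both parts are lifting problems for this covering.

For (a), `exists_lift_prod` lifts `f ∘ solenoidProj`. On one transversal `{y₀} × π̂₁(M₁)` local
inverses of the covering are patched over a clopen partition; each slice `W₁ × {g}` is simply
connected, so the lift extends along it uniquely, and uniqueness makes the family jointly
continuous. As `W₁` is connected and `π̂₁(M₂)` totally disconnected, the second coordinate depends
on `g` alone.

For (b), invariance of the leaves puts `h g` in the orbit `j(π₁) g`. The group is countable, so by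
Baire some `γ₀` satisfies `h g = j(γ₀) g` on a nonempty open set. The lift is equivariant up to
locally constant elements, and `j(π₁)` is dense, so this spreads to `h g = j(c g) g` with `c`
locally constant. Correcting the lift at `g` by `(c g)⁻¹` makes the second coordinate `g` without
changing the projection. -/

namespace SolenoidLift

/-! ### Lifting through covering maps over profinite parameters. -/

/-- On a profinite space, local choices can be patched to a locally constant choice. -/
theorem exists_locallyConstant_choice {X α : Type*} [TopologicalSpace X]
    [TotallyDisconnectedSpace X] [T2Space X] [CompactSpace X] {P : α → X → Prop}
    (h : ∀ x, ∃ a, ∀ᶠ x' in 𝓝 x, P a x') : ∃ c : LocallyConstant X α, ∀ x, P (c x) x := by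
  choose a ha using h
  have hU : TopologicalSpace.IsOpenCover fun x : X =>
      (⟨interior {x' | P (a x) x'}, isOpen_interior⟩ : TopologicalSpace.Opens X) :=
    TopologicalSpace.IsOpenCover.mk <| by
      ext x
      simp only [TopologicalSpace.Opens.coe_iSup, TopologicalSpace.Opens.coe_mk, Set.mem_iUnion,
        TopologicalSpace.Opens.coe_top, Set.mem_univ, iff_true]
      exact ⟨x, mem_interior_iff_mem_nhds.2 (ha x)⟩
  -- The cover by interiors refines to a finite partition into clopen sets; `k x` is the index of
  -- the piece containing `x`, locally constant by disjointness.
  obtain ⟨n, V, hV, hcov, hdisj⟩ := hU.exists_finite_nonempty_disjoint_clopen_cover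
  choose i hi using fun j => (hV j).2
  choose k hk using fun x => Set.mem_iUnion.1 (hcov (Set.mem_univ x))
  have hloc : IsLocallyConstant k := by
    refine (IsLocallyConstant.iff_eventually_eq k).2 fun x => ?_
    filter_upwards [(V (k x)).isOpen.mem_nhds (hk x)] with x' hx'
    by_contra hne
    have hd := hdisj hne
    exact Set.disjoint_left.1 (TopologicalSpace.Clopens.coe_disjoint.2 hd) (hk x') hx'
  exact ⟨⟨fun x => a (i (k x)), hloc.comp fun j => a (i j)⟩, fun x =>
    interior_subset (hi (k x) (hk x))⟩

/-- Maps of profinite spaces lift through surjective local homeomorphisms. -/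
theorem exists_lift_of_profinite {X E B : Type*} [TopologicalSpace X] [TopologicalSpace E]
    [TopologicalSpace B] [TotallyDisconnectedSpace X] [T2Space X] [CompactSpace X] {q : E → B}
    (hq : IsLocalHomeomorph q) (hs : Function.Surjective q) (f : C(X, B)) :
    ∃ s : C(X, E), ∀ x, q (s x) = f x := by
  choose ψ hψ hqψ using hq
  obtain ⟨c, hc⟩ := exists_locallyConstant_choice
    (P := fun (e : E) x => f x ∈ (ψ e).target) fun x => by
      obtain ⟨e, he⟩ := hs (f x)
      refine ⟨e, f.continuous.continuousAt.eventually_mem ((ψ e).open_target.mem_nhds ?_)⟩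
      rw [← he]
      nth_rw 1 [hqψ e]
      exact (ψ e).map_source (hψ e)
  refine ⟨⟨fun x => (ψ (c x)).symm (f x), ?_⟩, fun x => ?_⟩
  · refine continuous_iff_continuousAt.2 fun x => ?_
    have h1 : ContinuousAt (fun x' => (ψ (c x)).symm (f x')) x :=
      ((ψ (c x)).continuousAt_symm (hc x)).comp f.continuous.continuousAt
    refine h1.congr ?_
    filter_upwards [c.isLocallyConstant.eventually_eq x] with x' hx'
    exact congrArg (fun e => (ψ e).symm (f x')) (Eq.symm hx')
  · change q ((ψ (c x)).symm (f x)) = f x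
    rw [hqψ (c x)]
    exact (ψ (c x)).right_inv (hc x)

/-- A family of lifts, continuous on the slices `Y × {x}` and at one point of `Y`, is continuous. -/
theorem continuous_of_lift {X Y E B : Type*} [TopologicalSpace X] [TopologicalSpace Y]
    [TopologicalSpace E] [TopologicalSpace B] [PathConnectedSpace Y] [LocallyPathConnectedSpace Y]
    {q : E → B} (hq : IsCoveringMap q) (f : C(Y × X, B)) {F : Y × X → E}
    (hF : ∀ z, q (F z) = f z) (y₀ : Y) (h0 : Continuous fun x => F (y₀, x))
    (hslice : ∀ x, Continuous fun y => F (y, x)) : Continuous F := by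
  -- Continuity in `x` is transported from `y₀` to `y` along a path: over `I × X` the lift starts
  -- continuously and is continuous on each path, hence jointly continuous.
  have hvert : ∀ y, Continuous fun x => F (y, x) := by
    intro y
    let γ := PathConnectedSpace.somePath y₀ y
    have hc : Continuous fun z : unitInterval × X => F (γ z.1, z.2) :=
      hq.isLocalHomeomorph.continuous_lift hq.isSeparatedMap
        (f.comp ⟨fun z : unitInterval × X => (γ z.1, z.2), by fun_prop⟩)
        (funext fun z => hF _) (by simpa using h0) fun x => (hslice x).comp γ.continuous
    have h1 := hc.comp (Continuous.prodMk_right (1 : unitInterval))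
    simpa only [Function.comp_def, γ.target] using h1
  refine continuous_iff_continuousAt.2 fun ⟨y, x⟩ => ?_
  obtain ⟨ψ, hψ, hqψ⟩ := hq.isLocalHomeomorph (F (y, x))
  have hmem : f (y, x) ∈ ψ.target := by
    rw [← hF, hqψ]
    exact ψ.map_source hψ
  have hnear : f ⁻¹' ψ.target ∈ 𝓝 (y, x) :=
    f.continuous.continuousAt.preimage_mem_nhds (ψ.open_target.mem_nhds hmem)
  obtain ⟨V, hV, A, hA, hVA⟩ := mem_nhds_prod_iff.1 hnear
  obtain ⟨V', ⟨hV', hconn⟩, hVV'⟩ := (path_connected_basis y).mem_iff.1 hV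
  replace hVV' : V' ⊆ V := hVV'
  have hcontS : ContinuousOn (fun z => ψ.symm (f z)) (V ×ˢ A) :=
    ψ.continuousOn_symm.comp f.continuous.continuousOn hVA
  have hlift : ∀ z ∈ V ×ˢ A, q (ψ.symm (f z)) = f z := fun z hz => by
    rw [hqψ]
    exact ψ.right_inv (hVA hz)
  have hev : ∀ᶠ x' in 𝓝 x, F (y, x') ∈ ψ.source :=
    (hvert y).continuousAt.eventually_mem (ψ.open_source.mem_nhds hψ)
  have hstart : ∀ x', F (y, x') ∈ ψ.source → F (y, x') = ψ.symm (f (y, x')) := fun x' h => by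
    rw [← hF, hqψ, ψ.left_inv h]
  -- On each connected slice `V' × {x'}` both sides lift `f`, and they agree at `(y, x')` because
  -- `hvert` keeps `F (y, x')` in the sheet `ψ.source`. Uniqueness of lifts gives equality on the
  -- slice.
  have hEq : ∀ᶠ z in 𝓝 (y, x), ψ.symm (f z) = F z := by
    filter_upwards [prod_mem_nhds hV' (Filter.inter_mem hA hev)] with ⟨y', x'⟩ ⟨hy', hx', hsrc⟩
    refine hq.eqOn_of_comp_eqOn (g₁ := fun w => ψ.symm (f (w, x')))
      (g₂ := fun w => F (w, x')) hconn.isConnected.isPreconnected ?_ (hslice x').continuousOn ?_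
      (mem_of_mem_nhds hV') (hstart x' hsrc).symm hy'
    · exact hcontS.comp (Continuous.prodMk_left x').continuousOn fun w hw => ⟨hVV' hw, hx'⟩
    · exact fun w hw => (hlift (w, x') ⟨hVV' hw, hx'⟩).trans (hF (w, x')).symm
  exact (hcontS.continuousAt (prod_mem_nhds hV hA)).congr hEq

/-- Maps of the product of a simply connected space and a profinite space lift through surjective
covering maps. -/
theorem exists_lift_prod {X Y E B : Type*} [TopologicalSpace X] [TopologicalSpace Y]
    [TopologicalSpace E] [TopologicalSpace B] [SimplyConnectedSpace Y]
    [LocallyPathConnectedSpace Y] [TotallyDisconnectedSpace X] [T2Space X] [CompactSpace X]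
    {q : E → B} (hq : IsCoveringMap q) (hs : Function.Surjective q) (f : C(Y × X, B)) :
    ∃ F : C(Y × X, E), ∀ z, q (F z) = f z := by
  obtain ⟨y₀⟩ : Nonempty Y := inferInstance
  obtain ⟨s, hs⟩ := exists_lift_of_profinite hq.isLocalHomeomorph hs
    (f.comp ⟨fun x => (y₀, x), by fun_prop⟩)
  choose Φ hΦ _ using fun x => hq.existsUnique_continuousMap_lifts
    (f.comp ⟨fun y => (y, x), by fun_prop⟩) y₀ (s x) (hs x)
  have hF : ∀ z : Y × X, q (Φ z.2 z.1) = f z := fun z => congrFun (hΦ z.2).2 z.1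
  exact ⟨⟨fun z => Φ z.2 z.1, continuous_of_lift hq f hF y₀
    (by simpa only [(hΦ _).1] using s.continuous) fun x => (Φ x).continuous⟩, hF⟩

/-- The fibres of a covering of a second countable space by a path connected space are
countable. -/
theorem countable_fiber {E B : Type*} [TopologicalSpace E] [TopologicalSpace B]
    [PathConnectedSpace E] [SecondCountableTopology B] {q : E → B} (hq : IsCoveringMap q) (e : E) :
    Countable (q ⁻¹' {q e}) := by
  -- The loop space is second countable, hence separable. The end point of the lift from `e` maps it
  -- continuously onto the discrete fibre; surjectivity comes from projecting paths in `E`.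
  let A := Path (q e) (q e)
  have hA : SecondCountableTopology A :=
    TopologicalSpace.secondCountableTopology_induced _ C(unitInterval, B) _
  let H : C(unitInterval × A, B) := ⟨fun z => z.2 z.1, by fun_prop⟩
  let Γ := hq.liftHomotopy H (.const A e) fun a => a.source
  have hΓ : ∀ z, q (Γ z) = H z := fun z => congrFun (hq.liftHomotopy_lifts H _ _) z
  let r : A → q ⁻¹' {q e} := fun a => ⟨Γ (1, a), (hΓ _).trans a.target⟩
  have hr : Continuous r := by fun_prop
  have := (hq (q e)).1
  have hsurj : Function.Surjective r := by
    rintro ⟨w, hw⟩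
    let γ := PathConnectedSpace.somePath e w
    let a : A := (γ.map hq.continuous).cast rfl hw.symm
    refine ⟨a, Subtype.ext ?_⟩
    have h := (hq.eq_liftPath_iff (γ := a.toContinuousMap) (e := e) a.source (Γ := γ)).2
      ⟨γ.continuous, rfl, γ.source⟩
    exact (congrFun h 1).symm.trans γ.target
  have : TopologicalSpace.SeparableSpace A := inferInstance
  have h2 : TopologicalSpace.SeparableSpace (q ⁻¹' {q e}) :=
    hsurj.denseRange.separableSpace hr
  exact TopologicalSpace.separableSpace_iff_countable.1 h2

/-! ### Deck transformations: continuity, freeness, transitivity on fibres. -/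

section Deck

variable {M W : Type*} [TopologicalSpace M] [TopologicalSpace W]
  [SimplyConnectedSpace W] {p : W → M}

/-- `D` carries a path from `e` to `y` to the lift of its projection that starts at `D e`. -/
theorem monodromy_projClass_eq (hp : IsCoveringMap p) (e : W) (D : C(W, W))
    (hD : ∀ y, p (D y) = p y) (y : W) :
    (hp.monodromy (projClass hp e y) ⟨D e, hD e⟩).1 = D y := by
  let γ := PathConnectedSpace.somePath e y
  have h := (hp.eq_liftPath_iff (γ := (γ.map hp.continuous).toContinuousMap) (e := D e)
    ((γ.map hp.continuous).source.trans (hD e).symm) (Γ := fun t => D (γ t))).2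
      ⟨by fun_prop, funext fun t => hD _, congrArg D γ.source⟩
  exact (congrFun h 1).symm.trans (congrArg D γ.target)

/-- `deck` is defined pointwise by monodromy. The continuous lift `D` of `p` with the same value at
`e` agrees with it everywhere, by `monodromy_projClass_eq`. -/
theorem continuous_deck [LocallyPathConnectedSpace W] (hp : IsCoveringMap p) (e : W)
    (γ : FundamentalGroup M (p e)) : Continuous (deck hp e γ) := by
  obtain ⟨D, ⟨hDe, hD⟩, -⟩ := hp.existsUnique_continuousMap_lifts ⟨p, hp.continuous⟩ e
    (deck hp e γ e) (proj_deckFun hp e γ e)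
  have hD' : ∀ y, p (D y) = p y := congrFun hD
  have hw : hp.monodromy γ.toPath.symm ⟨e, rfl⟩ = ⟨D e, hD' e⟩ := by
    refine Subtype.ext (Eq.trans ?_ hDe.symm)
    change _ = deckFun hp e γ e
    have h1 : projClass hp e e = Path.Homotopic.Quotient.refl (p e) := by
      rw [projClass, ← pathClass_eq (Path.Homotopic.Quotient.refl e)]
      rfl
    rw [deckFun_eq, h1, hp.monodromy_refl]
    rfl
  have : (deck hp e γ : W → W) = D := by
    funext y
    change deckFun hp e γ y = D y
    rw [deckFun_eq, hw, monodromy_projClass_eq hp e D hD']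
  rw [this]
  exact D.continuous

/-- If `y` is fixed, `projClass_deckFun` says that `γ⁻¹` followed by the class of the path to `y` is
that class again; cancelling it in the groupoid leaves `γ = 1`. -/
theorem deck_free (hp : IsCoveringMap p) (e : W) {γ : FundamentalGroup M (p e)} {y : W}
    (h : deck hp e γ y = y) : γ = 1 := by
  have h1 := projClass_deckFun hp e γ y
  have h2 : ∀ (z : W) (_ : z = y) (hz : p z = p y),
      projClass hp e z = (projClass hp e y).cast rfl hz := by
    rintro z rfl hz
    exact (Path.Homotopic.Quotient.cast_rfl_rfl _).symm
  rw [h2 (deckFun hp e γ y) h (proj_deckFun hp e γ y)] at h1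
  have h3 := congrArg (fun q => Path.Homotopic.Quotient.trans
    (q.cast rfl (proj_deckFun hp e γ y).symm) (projClass hp e y).symm) h1
  simp only [Path.Homotopic.Quotient.cast_cast, Path.Homotopic.Quotient.cast_rfl_rfl,
    Path.Homotopic.Quotient.trans_symm, Path.Homotopic.Quotient.trans_assoc,
    Path.Homotopic.Quotient.trans_refl] at h3
  exact inv_eq_one.1 h3.symm

theorem deck_injective (hp : IsCoveringMap p) (e : W) {γ δ : FundamentalGroup M (p e)} {y : W}
    (h : deck hp e γ y = deck hp e δ y) : γ = δ := by
  refine (inv_mul_eq_one.1 (deck_free hp e (y := y) ?_)).symm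
  rw [map_mul, Equiv.Perm.mul_apply, h, ← Equiv.Perm.mul_apply, ← map_mul, inv_mul_cancel, map_one,
    Equiv.Perm.one_apply]

theorem exists_deck_eq (hp : IsCoveringMap p) (e : W) {y z : W} (h : p y = p z) :
    ∃ γ, deck hp e γ y = z := by
  -- Out along the path to `z`, back along the path to `y`: followed by the path to `y` this is the
  -- path to `z`. The witness is `δ⁻¹` because `deckFun` inverts its loop.
  let δ : FundamentalGroup M (p e) := .fromPath
    (((projClass hp e z).cast rfl h).trans (projClass hp e y).symm)
  refine ⟨δ⁻¹, ?_⟩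
  have h1 : FundamentalGroup.toPath (δ⁻¹)⁻¹ =
      ((projClass hp e z).cast rfl h).trans (projClass hp e y).symm := by
    rw [inv_inv]
  change (hp.monodromy (Path.Homotopic.Quotient.trans (FundamentalGroup.toPath (δ⁻¹)⁻¹)
    (projClass hp e y)) ⟨e, rfl⟩).1 = z
  rw [h1, Path.Homotopic.Quotient.trans_assoc, Path.Homotopic.Quotient.symm_trans,
    Path.Homotopic.Quotient.trans_refl, monodromy_cast]
  exact congrArg Subtype.val (hp.monodromy_map (pathClass e z))

end Deck

/-! ### The solenoidal projection is a covering map. -/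

section Covering

variable {M W : Type*} [TopologicalSpace M] [TopologicalSpace W]
  [SimplyConnectedSpace W] {p : W → M}

/-- The action `γ (y, g) = (γ y, j(γ) g)` of the fundamental group on `W × π̂₁(M)`. -/
@[reducible] noncomputable def diagAction (hp : IsCoveringMap p) (e : W) :
    MulAction (FundamentalGroup M (p e)) (W × ProfinitePi M (p e)) where
  smul γ z := (deck hp e γ z.1, toProfinitePi M (p e) γ * z.2)
  one_smul z := Prod.ext (deckFun_one hp e z.1) (one_mul z.2)
  mul_smul γ δ z := Prod.ext (deckFun_mul hp e γ δ z.1)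
    (mul_assoc (toProfinitePi M (p e) γ) (toProfinitePi M (p e) δ) z.2)

theorem Cover.mk_deck (hp : IsCoveringMap p) (e : W) {H : Subgroup (FundamentalGroup M (p e))}
    {γ : FundamentalGroup M (p e)} (hγ : γ ∈ H) (y : W) :
    Cover.mk hp e H (deck hp e γ y) = Cover.mk hp e H y :=
  (Quotient.sound ⟨γ, hγ, rfl⟩ : (_ : Quotient (deckSetoid hp e H)) = _).symm

theorem Cover.mk_eq_mk (hp : IsCoveringMap p) (e : W) {H : Subgroup (FundamentalGroup M (p e))}
    {y z : W} (h : Cover.mk hp e H y = Cover.mk hp e H z) : ∃ γ ∈ H, deck hp e γ y = z :=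
  Quotient.exact (s := deckSetoid hp e H) h

theorem Cover.mk_surjective (hp : IsCoveringMap p) (e : W)
    (H : Subgroup (FundamentalGroup M (p e))) : Function.Surjective (Cover.mk hp e H) :=
  Quotient.mk_surjective

theorem Cover.continuous_mk (hp : IsCoveringMap p) (e : W)
    (H : Subgroup (FundamentalGroup M (p e))) : Continuous (Cover.mk hp e H) :=
  continuous_quot_mk

theorem Cover.isOpenMap_mk [LocallyPathConnectedSpace W] (hp : IsCoveringMap p) (e : W)
    (H : Subgroup (FundamentalGroup M (p e))) : IsOpenMap (Cover.mk hp e H) := by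
  intro V hV
  change IsOpen (Cover.mk hp e H ⁻¹' (Cover.mk hp e H '' V))
  have : Cover.mk hp e H ⁻¹' (Cover.mk hp e H '' V) = ⋃ γ ∈ H, deck hp e γ ⁻¹' V := by
    ext y
    simp only [Set.mem_preimage, Set.mem_image, Set.mem_iUnion, exists_prop]
    constructor
    · rintro ⟨z, hz, hzy⟩
      obtain ⟨γ, hγ, rfl⟩ := Cover.mk_eq_mk hp e hzy.symm
      exact ⟨γ, hγ, hz⟩
    · rintro ⟨γ, hγ, hy⟩
      exact ⟨_, hy, Cover.mk_deck hp e hγ y⟩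
  rw [this]
  exact isOpen_biUnion fun γ _ => hV.preimage (continuous_deck hp e γ)

theorem cosetPoint_mk (hp : IsCoveringMap p) (e : W)
    (H : FiniteIndexNormalSubgroup (FundamentalGroup M (p e))) (c : FundamentalGroup M (p e))
    (y : W) : cosetPoint hp e H (QuotientGroup.mk c) y =
      Cover.mk hp e H.toSubgroup (deck hp e c⁻¹ y) :=
  rfl

/-- If `η ∈ H` takes `c⁻¹ y` to `d⁻¹ y`, freeness gives `η c⁻¹ = d⁻¹`, so `cH = dH`. -/
theorem cosetPoint_injective (hp : IsCoveringMap p) (e : W)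
    (H : FiniteIndexNormalSubgroup (FundamentalGroup M (p e))) (y : W) :
    Function.Injective fun c => cosetPoint hp e H c y := by
  intro c d h
  obtain ⟨c, rfl⟩ := QuotientGroup.mk_surjective c
  obtain ⟨d, rfl⟩ := QuotientGroup.mk_surjective d
  obtain ⟨η, hη, h⟩ := Cover.mk_eq_mk hp e h
  rw [← Equiv.Perm.mul_apply, ← map_mul] at h
  have h1 := deck_injective hp e h
  rw [QuotientGroup.eq, ← inv_inv d, ← h1, mul_inv_rev, inv_inv, inv_mul_cancel_left]
  exact H.toSubgroup.inv_mem hη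

theorem cosetPoint_deck (hp : IsCoveringMap p) (e : W)
    (H : FiniteIndexNormalSubgroup (FundamentalGroup M (p e))) (γ : FundamentalGroup M (p e))
    (c : FundamentalGroup M (p e) ⧸ H.toSubgroup) (y : W) :
    cosetPoint hp e H (QuotientGroup.mk γ * c) (deck hp e γ y) = cosetPoint hp e H c y := by
  obtain ⟨c, rfl⟩ := QuotientGroup.mk_surjective c
  rw [← QuotientGroup.mk_mul, cosetPoint_mk, cosetPoint_mk, ← Equiv.Perm.mul_apply, ← map_mul,
    mul_inv_rev, inv_mul_cancel_right]

theorem continuous_cosetPoint [LocallyPathConnectedSpace W] (hp : IsCoveringMap p) (e : W)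
    (H : FiniteIndexNormalSubgroup (FundamentalGroup M (p e)))
    (c : FundamentalGroup M (p e) ⧸ H.toSubgroup) : Continuous (cosetPoint hp e H c) := by
  obtain ⟨c, rfl⟩ := QuotientGroup.mk_surjective c
  exact (Cover.continuous_mk hp e _).comp (continuous_deck hp e c⁻¹)

/-- The covering projection of a cover of `M` onto `M`. -/
def Cover.proj (hp : IsCoveringMap p) (e : W) (H : Subgroup (FundamentalGroup M (p e))) :
    Cover hp e H → M :=
  Quotient.lift p (by
    rintro y _ ⟨γ, -, rfl⟩
    exact (proj_deckFun hp e γ y).symm)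

theorem Cover.proj_bond (hp : IsCoveringMap p) (e : W)
    {H K : Subgroup (FundamentalGroup M (p e))} (hHK : H ≤ K) (x : Cover hp e H) :
    Cover.proj hp e K (Cover.bond hp e hHK x) = Cover.proj hp e H x := by
  obtain ⟨y, rfl⟩ := Cover.mk_surjective hp e H x
  rfl

theorem proj_component_eq (hp : IsCoveringMap p) (e : W) (x : AlgUnivCover hp e)
    (H K : FiniteIndexNormalSubgroup (FundamentalGroup M (p e))) :
    Cover.proj hp e H.toSubgroup (x.1 H) = Cover.proj hp e K.toSubgroup (x.1 K) := by
  rw [← x.2 (H ⊓ K) H inf_le_left, ← x.2 (H ⊓ K) K inf_le_right, Cover.proj_bond, Cover.proj_bond]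

theorem bond_cosetPoint (hp : IsCoveringMap p) (e : W)
    {H K : FiniteIndexNormalSubgroup (FundamentalGroup M (p e))}
    (hHK : H.toSubgroup ≤ K.toSubgroup) (c : FundamentalGroup M (p e) ⧸ H.toSubgroup) (y : W) :
    Cover.bond hp e hHK (cosetPoint hp e H c y) =
      cosetPoint hp e K (QuotientGroup.map H.toSubgroup K.toSubgroup (MonoidHom.id _) hHK c) y := by
  obtain ⟨c, rfl⟩ := QuotientGroup.mk_surjective c
  rfl

theorem exists_cosetPoint_eq (hp : IsCoveringMap p) (e : W)
    (H : FiniteIndexNormalSubgroup (FundamentalGroup M (p e))) {y z : W} (h : p y = p z) :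
    ∃ c, cosetPoint hp e H c y = Cover.mk hp e H.toSubgroup z := by
  obtain ⟨γ, rfl⟩ := exists_deck_eq hp e h
  exact ⟨QuotientGroup.mk γ⁻¹, by rw [cosetPoint_mk, inv_inv]⟩

theorem isLocallyConstant_component {x : M}
    (H : FiniteIndexNormalSubgroup (FundamentalGroup M x)) :
    IsLocallyConstant fun g : ProfinitePi M x => component g H := by
  let D := (ProfiniteGrp.ProfiniteCompletion.diagram (GrpCat.of (FundamentalGroup M x))).obj H
  have h1 : Continuous fun g : ProfinitePi M x => (g.1 H : D) :=
    (continuous_apply H).comp continuous_subtype_val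
  have : Finite D := inferInstanceAs (Finite (FundamentalGroup M x ⧸ H.toSubgroup))
  exact (IsLocallyConstant.iff_continuous fun g : ProfinitePi M x => (g.1 H : D)).2 h1

/-- The sets of elements with a given component form a neighbourhood basis. -/
theorem exists_component_subset {x : M} (g : ProfinitePi M x) {N : Set (ProfinitePi M x)}
    (hN : N ∈ 𝓝 g) : ∃ H, {g' | component g' H = component g H} ⊆ N := by
  obtain ⟨s, hs, hsN⟩ := mem_nhds_induced _ g N |>.1 hN
  rw [nhds_pi] at hs
  obtain ⟨I, t, ht, hts⟩ := Filter.mem_pi'.1 hs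
  have : Nonempty (FiniteIndexNormalSubgroup (FundamentalGroup M x)) := ⟨.ofSubgroup ⊤⟩
  -- A basic neighbourhood constrains finitely many components, and all of them are determined by
  -- the component at one common lower bound `H`.
  obtain ⟨H, hH⟩ := I.bddBelow
  refine ⟨H, fun g' hg' => hsN (hts fun K hK => ?_)⟩
  have hK' : component g' K = component g K := by
    have hHK : H.toSubgroup ≤ K.toSubgroup := hH hK
    rw [← map_component g' hHK, ← map_component g hHK, show component g' H = component g H from hg']
  exact Set.mem_of_eq_of_mem hK' (mem_of_mem_nhds (ht K))

theorem solenoidProj_apply (hp : IsCoveringMap p) (e : W) (z : W × ProfinitePi M (p e)) (H) :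
    (solenoidProj hp e z).1 H = cosetPoint hp e H (component z.2 H) z.1 :=
  rfl

theorem solenoidProj_deck (hp : IsCoveringMap p) (e : W) (γ : FundamentalGroup M (p e)) (y : W)
    (g : ProfinitePi M (p e)) :
    solenoidProj hp e (deck hp e γ y, toProfinitePi M (p e) γ * g) = solenoidProj hp e (y, g) :=
  Subtype.ext <| funext fun H => cosetPoint_deck hp e H γ (component g H) y

theorem continuous_solenoidProj [LocallyPathConnectedSpace W] (hp : IsCoveringMap p) (e : W) :
    Continuous (solenoidProj hp e) := by
  refine Continuous.subtype_mk (continuous_pi fun H => ?_) _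
  refine continuous_iff_continuousAt.2 fun ⟨y, g⟩ => ?_
  refine ((continuous_cosetPoint hp e H (component g H)).comp continuous_fst).continuousAt.congr ?_
  filter_upwards [continuous_snd.continuousAt.eventually
    ((isLocallyConstant_component H).eventually_eq g)] with z hz
  exact congrArg (fun c => cosetPoint hp e H c z.1) hz.symm

/-- The first coordinate may be any point over the image of `x` in `M`. Each component of `x` then
determines its coset, and uniqueness (`cosetPoint_injective`) makes the cosets compatible. This
freedom also gives openness. -/
theorem exists_solenoidProj_eq (hp : IsCoveringMap p) (e : W) (x : AlgUnivCover hp e) {y : W}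
    {H₀ : FiniteIndexNormalSubgroup (FundamentalGroup M (p e))}
    (hy : p y = Cover.proj hp e H₀.toSubgroup (x.1 H₀)) :
    ∃ g, solenoidProj hp e (y, g) = x := by
  have h : ∀ H : FiniteIndexNormalSubgroup (FundamentalGroup M (p e)),
      ∃ c, cosetPoint hp e H c y = x.1 H := by
    intro H
    obtain ⟨z, hz⟩ := Cover.mk_surjective hp e H.toSubgroup (x.1 H)
    rw [← hz]
    refine exists_cosetPoint_eq hp e H (hy.trans ?_)
    rw [proj_component_eq hp e x H₀ H, ← hz]
    rfl
  choose c hc using h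
  have hmap : ∀ (H K : FiniteIndexNormalSubgroup (FundamentalGroup M (p e)))
      (hHK : H.toSubgroup ≤ K.toSubgroup),
      QuotientGroup.map H.toSubgroup K.toSubgroup (MonoidHom.id _) hHK (c H) = c K := by
    intro H K hHK
    refine cosetPoint_injective hp e K y ?_
    change cosetPoint hp e K _ y = cosetPoint hp e K _ y
    rw [← bond_cosetPoint, hc, hc, x.2 H K hHK]
  exact ⟨⟨c, fun H K f => hmap H K (CategoryTheory.leOfHom f)⟩, Subtype.ext (funext hc)⟩

theorem solenoidProj_surjective (hp : IsCoveringMap p) (e : W) :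
    Function.Surjective (solenoidProj hp e) := by
  intro x
  let H₀ : FiniteIndexNormalSubgroup (FundamentalGroup M (p e)) := .ofSubgroup ⊤
  obtain ⟨y, hy⟩ := Cover.mk_surjective hp e H₀.toSubgroup (x.1 H₀)
  obtain ⟨g, hg⟩ := exists_solenoidProj_eq hp e x (y := y) (H₀ := H₀) (by rw [← hy]; rfl)
  exact ⟨_, hg⟩

theorem eq_of_solenoidProj_eq (hp : IsCoveringMap p) (e : W) {y : W} {g g' : ProfinitePi M (p e)}
    (h : solenoidProj hp e (y, g) = solenoidProj hp e (y, g')) : g = g' :=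
  Subtype.ext <| funext fun H => cosetPoint_injective hp e H y (congrFun (congrArg Subtype.val h) H)

theorem solenoidProj_eq_iff (hp : IsCoveringMap p) (e : W) {z w : W × ProfinitePi M (p e)} :
    solenoidProj hp e z = solenoidProj hp e w ↔
      ∃ γ, (deck hp e γ w.1, toProfinitePi M (p e) γ * w.2) = z := by
  obtain ⟨y, g⟩ := z
  obtain ⟨y', g'⟩ := w
  constructor
  · intro h
    let H₀ : FiniteIndexNormalSubgroup (FundamentalGroup M (p e)) := .ofSubgroup ⊤
    have hproj : ∀ (z : W) (c : FundamentalGroup M (p e) ⧸ H₀.toSubgroup),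
        Cover.proj hp e H₀.toSubgroup (cosetPoint hp e H₀ c z) = p z := by
      intro z c
      obtain ⟨c, rfl⟩ := QuotientGroup.mk_surjective c
      exact proj_deckFun hp e c⁻¹ z
    have h1 := congrArg (fun x => Cover.proj hp e H₀.toSubgroup (x.1 H₀)) h
    simp only [solenoidProj_apply, hproj] at h1
    obtain ⟨γ, rfl⟩ := exists_deck_eq hp e h1.symm
    refine ⟨γ, Prod.ext rfl (eq_of_solenoidProj_eq hp e (y := deck hp e γ y') ?_)⟩
    exact (solenoidProj_deck hp e γ y' g').trans h.symm
  · rintro ⟨γ, h⟩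
    rw [← h]
    exact solenoidProj_deck hp e γ y' g'

/-- A neighbourhood of `(y, g)` contains `V' × {g' | g'_H = cH}`. The image of the latter contains
every `x` whose component at `H` lies in the open image of `c⁻¹ V'`: such an `x` has a preimage with
first coordinate in `V'`, and this forces its `H`-component to be `cH`. -/
theorem isOpenMap_solenoidProj [LocallyPathConnectedSpace W] (hp : IsCoveringMap p) (e : W) :
    IsOpenMap (solenoidProj hp e) := by
  refine IsOpenMap.of_nhds_le fun ⟨y, g⟩ S hS => ?_
  obtain ⟨V, hV, N, hN, hVN⟩ := mem_nhds_prod_iff.1 (Filter.mem_map.1 hS)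
  obtain ⟨V', hV'V, hV'o, hyV'⟩ := mem_nhds_iff.1 hV
  obtain ⟨H, hH⟩ := exists_component_subset g hN
  obtain ⟨c, hc⟩ := QuotientGroup.mk_surjective (component g H)
  have hopen : IsOpen (Cover.mk hp e H.toSubgroup '' (deck hp e c⁻¹ '' V')) := by
    refine Cover.isOpenMap_mk hp e _ _ ?_
    rw [Equiv.image_eq_preimage_symm, ← Equiv.Perm.inv_def, ← map_inv, inv_inv]
    exact hV'o.preimage (continuous_deck hp e c)
  let r : AlgUnivCover hp e → Cover hp e H.toSubgroup := fun x => x.1 H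
  have hcont : Continuous r := (continuous_apply H).comp continuous_subtype_val
  refine Filter.mem_of_superset ((hopen.preimage hcont).mem_nhds ?_) ?_
  · refine ⟨_, ⟨y, hyV', rfl⟩, ?_⟩
    change Cover.mk hp e _ (deck hp e c⁻¹ y) = cosetPoint hp e H (component g H) y
    rw [← hc]
    rfl
  · rintro x ⟨_, ⟨z, hz, rfl⟩, hx⟩
    obtain ⟨g', rfl⟩ := exists_solenoidProj_eq hp e x (y := z) (H₀ := H)
      ((proj_deckFun hp e c⁻¹ z).symm.trans (congrArg (Cover.proj hp e H.toSubgroup) hx))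
    refine hVN ⟨hV'V hz, hH ?_⟩
    exact (cosetPoint_injective hp e H z (hx.symm.trans (by rw [← hc]; rfl) :
      cosetPoint hp e H (component g' H) z = cosetPoint hp e H (component g H) z))

/-- The solenoidal covering projection is the quotient covering map of the diagonal action. -/
theorem isQuotientCoveringMap_solenoidProj [LocallyPathConnectedSpace W] (hp : IsCoveringMap p)
    (e : W) : letI := diagAction hp e
    IsQuotientCoveringMap (solenoidProj hp e) (FundamentalGroup M (p e)) := by
  let _ := diagAction hp e
  refine { toIsQuotientMap := (isOpenMap_solenoidProj hp e).isQuotientMap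
              (continuous_solenoidProj hp e) (solenoidProj_surjective hp e)
           continuous_const_smul := fun γ => ?_
           apply_eq_iff_mem_orbit := solenoidProj_eq_iff hp e
           disjoint := fun ⟨y, g⟩ => ?_ }
  · exact ((continuous_deck hp e γ).comp continuous_fst).prodMk
      (continuous_const.mul continuous_snd)
  -- Deck transformations preserve the fibres of `p`, so one that returns a point to a set where `p`
  -- is injective fixes it. The second factor needs no restriction.
  · obtain ⟨ψ, hy, hψ⟩ := hp.isLocalHomeomorph y
    refine ⟨ψ.source ×ˢ Set.univ, prod_mem_nhds (ψ.open_source.mem_nhds hy) Filter.univ_mem, ?_⟩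
    rintro γ ⟨_, ⟨z, hz, rfl⟩, hz'⟩
    refine deck_free hp e (ψ.injOn hz'.1 hz.1 ?_)
    rw [← hψ]
    exact proj_deckFun hp e γ z.1

end Covering

/-! ### Lifts in product form. -/

theorem snd_eq_of_continuous {Y Z X : Type*} [TopologicalSpace X] [TopologicalSpace Y]
    [TopologicalSpace Z] [PreconnectedSpace Y] [TotallyDisconnectedSpace X] {F : Y → Z × X}
    (hF : Continuous F) (y y' : Y) : (F y).2 = (F y').2 :=
  (isPreconnected_range (continuous_snd.comp hF)).subsingleton ⟨y, rfl⟩ ⟨y', rfl⟩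

theorem isCoveringMap_solenoidProj {M W : Type*} [TopologicalSpace M] [TopologicalSpace W]
    [SimplyConnectedSpace W] [LocallyPathConnectedSpace W] {p : W → M} (hp : IsCoveringMap p)
    (e : W) : IsCoveringMap (solenoidProj hp e) :=
  let _ := diagAction hp e
  (isQuotientCoveringMap_solenoidProj hp e).isCoveringMap

/-- Continuous maps between algebraic universal covers lift to product maps of the form
`(y, g) ↦ (φ g y, h g)`. -/
theorem exists_solenoid_lift {M₁ W₁ M₂ W₂ : Type*} [TopologicalSpace M₁] [TopologicalSpace W₁]
    [SimplyConnectedSpace W₁] [LocallyPathConnectedSpace W₁] [TopologicalSpace M₂]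
    [TopologicalSpace W₂] [SimplyConnectedSpace W₂] [LocallyPathConnectedSpace W₂]
    {p₁ : W₁ → M₁} (hp₁ : IsCoveringMap p₁) (e₁ : W₁) {p₂ : W₂ → M₂} (hp₂ : IsCoveringMap p₂)
    (e₂ : W₂) (f : C(AlgUnivCover hp₁ e₁, AlgUnivCover hp₂ e₂)) :
    ∃ (h : C(ProfinitePi M₁ (p₁ e₁), ProfinitePi M₂ (p₂ e₂)))
      (φ : ProfinitePi M₁ (p₁ e₁) → C(W₁, W₂))
      (F : C(W₁ × ProfinitePi M₁ (p₁ e₁), W₂ × ProfinitePi M₂ (p₂ e₂))),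
      (∀ y g, F (y, g) = (φ g y, h g)) ∧
      ∀ z, f (solenoidProj hp₁ e₁ z) = solenoidProj hp₂ e₂ (F z) := by
  obtain ⟨F, hF⟩ := exists_lift_prod (isCoveringMap_solenoidProj hp₂ e₂)
    (solenoidProj_surjective hp₂ e₂) (f.comp ⟨solenoidProj hp₁ e₁, continuous_solenoidProj hp₁ e₁⟩)
  refine ⟨⟨fun g => (F (e₁, g)).2, by fun_prop⟩, fun g => ⟨fun y => (F (y, g)).1, by fun_prop⟩, F,
    fun y g => Prod.ext rfl ?_, fun z => (hF z).symm⟩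
  exact snd_eq_of_continuous (F := fun y => F (y, g)) (by fun_prop) y e₁

/-! ### Leaf-preserving maps. -/

section Leaves

variable {M W : Type*} [TopologicalSpace M] [TopologicalSpace W]
  [SimplyConnectedSpace W] {p : W → M}

theorem countable_fundamentalGroup [SecondCountableTopology M] (hp : IsCoveringMap p) (e : W) :
    Countable (FundamentalGroup M (p e)) := by
  have := countable_fiber hp e
  let r : FundamentalGroup M (p e) → p ⁻¹' {p e} := fun γ => ⟨deck hp e γ e, proj_deckFun hp e γ e⟩
  have hr : Function.Injective r := fun γ δ h => deck_injective hp e (congrArg Subtype.val h)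
  exact hr.countable

theorem toProfinitePi_mul {x : M} (γ δ : FundamentalGroup M x) :
    toProfinitePi M x (γ * δ) = toProfinitePi M x γ * toProfinitePi M x δ :=
  rfl

variable [LocallyPathConnectedSpace W]

/-- Points over the same path component have transverse coordinates in the same orbit. -/
theorem exists_eq_mul_of_joined (hp : IsCoveringMap p) (e : W)
    {z w : W × ProfinitePi M (p e)} (h : Joined (solenoidProj hp e z) (solenoidProj hp e w)) :
    ∃ γ, w.2 = toProfinitePi M (p e) γ * z.2 := by
  obtain ⟨γ⟩ := h
  -- The second coordinate is constant along the lifted path, whose end point lies in the orbit of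
  -- `w`.
  obtain ⟨Γ, hΓ, hΓ0⟩ := (isCoveringMap_solenoidProj hp e).exists_path_lifts γ z γ.source
  have h1 : solenoidProj hp e w = solenoidProj hp e (Γ 1) :=
    γ.target.symm.trans (congrFun hΓ 1).symm
  obtain ⟨δ, rfl⟩ := (solenoidProj_eq_iff hp e).1 h1
  refine ⟨δ, ?_⟩
  rw [← hΓ0, snd_eq_of_continuous Γ.continuous 0 1]

/-- If a lift `F` over `h` of a self-map sends every point `g` of the transversal into its orbit,
then the element of the fundamental group taking `g` to `h g` can be chosen locally constant. By the
Baire category theorem it is constant on a nonempty open set, as the fundamental group is countable;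
the translates of that set by the dense image of the fundamental group cover the transversal. -/
theorem exists_locallyConstant_translation [SecondCountableTopology M] (hp : IsCoveringMap p)
    (e : W) {f : AlgUnivCover hp e → AlgUnivCover hp e}
    (F : C(W × ProfinitePi M (p e), W × ProfinitePi M (p e)))
    (hF : ∀ z, f (solenoidProj hp e z) = solenoidProj hp e (F z))
    (h : C(ProfinitePi M (p e), ProfinitePi M (p e))) (hFh : ∀ y g, (F (y, g)).2 = h g)
    (horbit : ∀ g, ∃ γ, h g = toProfinitePi M (p e) γ * g) :
    ∃ c : LocallyConstant (ProfinitePi M (p e)) (FundamentalGroup M (p e)),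
      ∀ g, h g = toProfinitePi M (p e) (c g) * g := by
  have := countable_fundamentalGroup hp e
  let A : FundamentalGroup M (p e) → Set (ProfinitePi M (p e)) :=
    fun γ => {g | h g = toProfinitePi M (p e) γ * g}
  obtain ⟨γ₀, u, hu⟩ := nonempty_interior_of_iUnion_of_closed (f := A)
    (fun γ => isClosed_eq h.continuous (continuous_const.mul continuous_id))
    (Set.eq_univ_of_forall fun g => Set.mem_iUnion.2 (horbit g))
  refine exists_locallyConstant_choice (X := ProfinitePi M (p e))
    (P := fun γ g => h g = toProfinitePi M (p e) γ * g) fun x => ?_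
  -- Density of `j(π₁)` supplies `δ` moving `x` into the open set where `γ₀` works.
  obtain ⟨_, hδ, δ, rfl⟩ := (ProfiniteGrp.ProfiniteCompletion.denseRange
    (GrpCat.of (FundamentalGroup M (p e)))).inter_open_nonempty
    ((fun a : ProfinitePi M (p e) => a * x) ⁻¹' interior (A γ₀))
    (isOpen_interior.preimage (continuous_mul_const x))
    ⟨u * x⁻¹, by simpa using hu⟩
  change toProfinitePi M (p e) δ * x ∈ interior (A γ₀) at hδ
  have hlift : ∀ x', solenoidProj hp e (F (deck hp e δ e, toProfinitePi M (p e) δ * x')) =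
      solenoidProj hp e (F (e, x')) := fun x' => by
    rw [← hF, solenoidProj_deck, hF]
  obtain ⟨θ, hθ⟩ := (solenoidProj_eq_iff hp e).1 (hlift x)
  -- `θ` was found at `x` only. Two continuous lifts of one map agree on an open set, so `F (δ (e,
  -- x')) = θ F (e, x')` for all `x'` near `x`.
  have hinj := (isCoveringMap_solenoidProj hp e).isLocalHomeomorph.isLocallyInjective
  have hopen := hinj.isOpen_eqLocus
    (g₁ := fun x' => F (deck hp e δ e, toProfinitePi M (p e) δ * x'))
    (g₂ := fun x' => (deck hp e θ (F (e, x')).1, toProfinitePi M (p e) θ * (F (e, x')).2))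
    (F.continuous.comp (continuous_const.prodMk (continuous_const_mul _)))
    (((continuous_deck hp e θ).comp (by fun_prop)).prodMk
      (continuous_const.mul (by fun_prop)))
    (funext fun x' => (hlift x').trans (solenoidProj_deck hp e θ _ _).symm)
  -- Second coordinates give `j(θ) h(x') = h(j(δ) x') = j(γ₀ δ) x'`.
  refine ⟨θ⁻¹ * γ₀ * δ, ?_⟩
  filter_upwards [hopen.mem_nhds hθ.symm, (continuous_const_mul _).continuousAt.preimage_mem_nhds
    (isOpen_interior.mem_nhds hδ)] with x' h1 h2
  have h3 : toProfinitePi M (p e) θ * h x' =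
      toProfinitePi M (p e) γ₀ * (toProfinitePi M (p e) δ * x') := by
    have h4 : (F (deck hp e δ e, toProfinitePi M (p e) δ * x')).2 =
        toProfinitePi M (p e) θ * (F (e, x')).2 := congrArg Prod.snd h1
    rw [hFh, hFh] at h4
    have h5 : toProfinitePi M (p e) δ * x' ∈ A γ₀ := interior_subset h2
    exact h4.symm.trans h5
  refine mul_left_cancel (a := toProfinitePi M (p e) θ) (h3.trans ?_)
  rw [← mul_assoc, ← mul_assoc, ← toProfinitePi_mul, ← toProfinitePi_mul, mul_assoc θ⁻¹,
    mul_inv_cancel_left]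

/-- A self-map preserving the leaves lifts to a map of the form `(y, g) ↦ (φ g y, g)`. -/
theorem exists_solenoid_lift_of_leaf [SecondCountableTopology M] (hp : IsCoveringMap p) (e : W)
    (f : C(AlgUnivCover hp e, AlgUnivCover hp e)) (hf : ∀ x, Joined x (f x)) :
    ∃ (φ : ProfinitePi M (p e) → C(W, W))
      (F : C(W × ProfinitePi M (p e), W × ProfinitePi M (p e))),
      (∀ y g, F (y, g) = (φ g y, g)) ∧
      ∀ z, f (solenoidProj hp e z) = solenoidProj hp e (F z) := by
  obtain ⟨h, φ, F, hFφ, hF⟩ := exists_solenoid_lift hp e hp e f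
  obtain ⟨c, hc⟩ := exists_locallyConstant_translation hp e F hF h (fun y g => by rw [hFφ])
    fun g => by
      have h1 := hf (solenoidProj hp e (e, g))
      rw [hF, hFφ] at h1
      exact exists_eq_mul_of_joined hp e h1
  have hcont : Continuous fun z : W × ProfinitePi M (p e) => deck hp e (c z.2)⁻¹ (F z).1 := by
    refine continuous_iff_continuousAt.2 fun z => ?_
    have h1 : Continuous fun z' => deck hp e (c z.2)⁻¹ (F z').1 :=
      (continuous_deck hp e _).comp (by fun_prop)
    refine h1.continuousAt.congr ?_
    filter_upwards [continuous_snd.continuousAt.eventually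
      (c.isLocallyConstant.eventually_eq z.2)] with z' hz'
    exact congrArg (fun γ => deck hp e γ⁻¹ (F z').1) (Eq.symm hz')
  refine ⟨fun g => ⟨fun y => deck hp e (c g)⁻¹ (φ g y), (continuous_deck hp e _).comp
    (φ g).continuous⟩, ⟨fun z => (deck hp e (c z.2)⁻¹ (F z).1, z.2), hcont.prodMk continuous_snd⟩,
    fun y g => by simp [hFφ], fun ⟨y, g⟩ => ?_⟩
  rw [hF, hFφ, ← solenoidProj_deck hp e (c g)⁻¹, hc, ← mul_assoc, ← toProfinitePi_mul,
    inv_mul_cancel]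
  change _ = solenoidProj hp e (deck hp e (c g)⁻¹ (F (y, g)).1, g)
  rw [hFφ]
  exact congrArg (fun g' => solenoidProj hp e (deck hp e (c g)⁻¹ (φ g y), g')) (one_mul g)

end Leaves

end SolenoidLift

theorem mainTheorem9 {n₁ n₂ : ℕ} {M₁ W₁ M₂ W₂ : Type*}
    -- `M₁` is a compact connected smooth manifold with infinite residually finite fundamental
    -- group, and `p₁ : W₁ → M₁` is its universal cover
    [TopologicalSpace M₁] [T2Space M₁] [CompactSpace M₁] [ConnectedSpace M₁]
    [ChartedSpace (EuclideanSpace ℝ (Fin n₁)) M₁] [IsManifold (𝓡 n₁) ∞ M₁]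
    [TopologicalSpace W₁] [SimplyConnectedSpace W₁]
    [ChartedSpace (EuclideanSpace ℝ (Fin n₁)) W₁] [IsManifold (𝓡 n₁) ∞ W₁]
    (p₁ : W₁ → M₁) (hp₁ : IsCoveringMap p₁) (_ : IsLocalDiffeomorph (𝓡 n₁) (𝓡 n₁) ∞ p₁) (e₁ : W₁)
    [Infinite (FundamentalGroup M₁ (p₁ e₁))]
    [Group.ResiduallyFinite (FundamentalGroup M₁ (p₁ e₁))]
    -- the same for `p₂ : W₂ → M₂`
    [TopologicalSpace M₂] [T2Space M₂] [CompactSpace M₂] [ConnectedSpace M₂]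
    [ChartedSpace (EuclideanSpace ℝ (Fin n₂)) M₂] [IsManifold (𝓡 n₂) ∞ M₂]
    [TopologicalSpace W₂] [SimplyConnectedSpace W₂]
    [ChartedSpace (EuclideanSpace ℝ (Fin n₂)) W₂] [IsManifold (𝓡 n₂) ∞ W₂]
    (p₂ : W₂ → M₂) (hp₂ : IsCoveringMap p₂) (_ : IsLocalDiffeomorph (𝓡 n₂) (𝓡 n₂) ∞ p₂) (e₂ : W₂)
    [Infinite (FundamentalGroup M₂ (p₂ e₂))]
    [Group.ResiduallyFinite (FundamentalGroup M₂ (p₂ e₂))] :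
    (∀ f : C(SolenoidLift.AlgUnivCover hp₁ e₁, SolenoidLift.AlgUnivCover hp₂ e₂),
      ∃ (h : C(SolenoidLift.ProfinitePi M₁ (p₁ e₁), SolenoidLift.ProfinitePi M₂ (p₂ e₂)))
        (φ : SolenoidLift.ProfinitePi M₁ (p₁ e₁) → C(W₁, W₂))
        (F : C(W₁ × SolenoidLift.ProfinitePi M₁ (p₁ e₁),
          W₂ × SolenoidLift.ProfinitePi M₂ (p₂ e₂))),
        (∀ y g, F (y, g) = (φ g y, h g)) ∧
        ∀ z, f (SolenoidLift.solenoidProj hp₁ e₁ z) = SolenoidLift.solenoidProj hp₂ e₂ (F z)) ∧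
    ((∃ m : SolenoidLift.LaminatedMetric (n := n₂) hp₂ e₂,
        ∀ g, (m.metric g).IsNegativelyCurved) →
      ∀ f : C(SolenoidLift.AlgUnivCover hp₂ e₂, SolenoidLift.AlgUnivCover hp₂ e₂),
        (∀ L, SolenoidLift.IsLeaf hp₂ e₂ L → f '' L = L) →
        ∃ (φ : SolenoidLift.ProfinitePi M₂ (p₂ e₂) → C(W₂, W₂))
          (F : C(W₂ × SolenoidLift.ProfinitePi M₂ (p₂ e₂),
            W₂ × SolenoidLift.ProfinitePi M₂ (p₂ e₂))),
          (∀ y g, F (y, g) = (φ g y, g)) ∧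
          ∀ z, f (SolenoidLift.solenoidProj hp₂ e₂ z) = SolenoidLift.solenoidProj hp₂ e₂ (F z)) := by
  have := ChartedSpace.locallyPathConnectedSpace (EuclideanSpace ℝ (Fin n₁)) W₁
  have := ChartedSpace.locallyPathConnectedSpace (EuclideanSpace ℝ (Fin n₂)) W₂
  -- Second countability of `M₂` makes its fundamental group countable, as the Baire argument
  -- requires.
  have := ChartedSpace.secondCountable_of_sigmaCompact (EuclideanSpace ℝ (Fin n₂)) M₂
  refine ⟨SolenoidLift.exists_solenoid_lift hp₁ e₁ hp₂ e₂, fun _ f hf =>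
    SolenoidLift.exists_solenoid_lift_of_leaf hp₂ e₂ f fun x => ?_⟩
  have hx : f x ∈ f '' pathComponent x := ⟨x, mem_pathComponent_self x, rfl⟩
  rwa [hf _ ⟨x, rfl⟩] at hx
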